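/- Let $\lambda>1$ and $\beta>2$. For $T>0$ and functions $f_n\in L_2(0,T)$, $n\ge 1$, with $\sum_{n=1}^\infty\lambda^{-2n}\int_0^T f_n(t)^2\,dt<\infty$, consider the dyadic system with zero initial data $$\dot u_n+\lambda^{2n}u_n-\lambda^{\beta n}u_{n-1}^2+\lambda^{\beta(n+1)}u_nu_{n+1}=f_n\ \text{ on } [0,T],\qquad u_n(0)=0,\qquad n=1,2,\dots,\qquad u_0\equiv 0.$$ A sequence $\{u_n\}_{n\ge1}$ of real functions on $[0,T]$ is called a Leray–Hopf solution if (i) $u_n\in W_2^1(0,T)$ and the system holds for all $n\ge1$ (the differential equations almost everywhere); (ii) $\sup_{t\in[0,T]}\sum_{n=1}^\infty u_n(t)^2<\infty$ and $\sum_{n=1}^\infty\lambda^{2n}\int_0^T u_n(t)^2\,dt<\infty$; (iii) for all $t\in[0,T]$, $$\sum_{n=1}^\infty\Bigl(u_n(t)^2+2\lambda^{2n}\int_0^t u_n(\tau)^2\,d\tau\Bigr)\le 2\sum_{n=1}^\infty\int_0^t f_n(\tau)u_n(\tau)\,d\tau .$$ Then there exist $T>0$ and functions $f_n\in L_2(0,T)$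 with $\sum_{n=1}^\infty\lambda^{-2n}\int_0^T f_n(t)^2\,dt<\infty$ such that the system has two different Leray–Hopf solutions on $[0,T]$, both of which satisfy (iii) with equality for every $t\in[0,T]$. -/

import Mathlib

open MeasureTheory Set
open scoped ContDiff

noncomputable section

/-- `w` is the weak derivative of `u` on the interval `(0, T)`. -/
def IsWeakDeriv (T : ℝ) (u w : ℝ → ℝ) : Prop :=
  ∀ φ : ℝ → ℝ, ContDiff ℝ ∞ φ → HasCompactSupport φ → tsupport φ ⊆ Ioo 0 T →
    ∫ t in Ioo 0 T, u t * deriv φ t = -∫ t in Ioo 0 T, w t * φ t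

/-- `u ∈ W_2^1(0, T)`, taken as its continuous representative on `[0, T]`, with weak derivative
`w ∈ L_2(0, T)`. -/
structure HasW12Deriv (T : ℝ) (u w : ℝ → ℝ) : Prop where
  continuousOn : ContinuousOn u (Icc 0 T)
  memLp : MemLp u 2 (volume.restrict (Ioo 0 T))
  memLp_deriv : MemLp w 2 (volume.restrict (Ioo 0 T))
  isWeakDeriv : IsWeakDeriv T u w

/-- The standing assumptions on initial data `a` and right-hand sides `f`. Sequences are indexed
by `n = 1, 2, …` (series run over `n + 1`, `n : ℕ`); the values `a 0` and `f 0` are irrelevant. -/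
structure AdmissibleData (lam T : ℝ) (a : ℕ → ℝ) (f : ℕ → ℝ → ℝ) : Prop where
  summable_init : Summable fun n : ℕ => a (n + 1) ^ 2
  memLp_force : ∀ n : ℕ, 1 ≤ n → MemLp (f n) 2 (volume.restrict (Ioo 0 T))
  summable_force :
    Summable fun n : ℕ => (lam ^ (2 * (n + 1)))⁻¹ * ∫ t in (0 : ℝ)..T, f (n + 1) t ^ 2

/-- `u` solves the dyadic system on `[0, T]`: every `u n`, `n ≥ 1`, lies in `W_2^1(0, T)`,
`u 0 ≡ 0`, the `n`-th equation holds almost everywhere on `(0, T)`, and `u n 0 = a n`. -/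
structure SolvesDyadic (lam β T : ℝ) (a : ℕ → ℝ) (f u : ℕ → ℝ → ℝ) : Prop where
  zero : ∀ t ∈ Icc 0 T, u 0 t = 0
  init : ∀ n : ℕ, 1 ≤ n → u n 0 = a n
  equation : ∀ n : ℕ, 1 ≤ n → ∃ w : ℝ → ℝ, HasW12Deriv T (u n) w ∧
    ∀ᵐ t ∂(volume.restrict (Ioo 0 T)),
      w t + lam ^ (2 * n) * u n t - lam ^ (β * (n : ℝ)) * u (n - 1) t ^ 2
        + lam ^ (β * ((n : ℝ) + 1)) * u n t * u (n + 1) t = f n t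

/-- The `n`-th term on the left of the energy relation at time `t`. -/
def energyTerm (lam : ℝ) (u : ℕ → ℝ → ℝ) (t : ℝ) (n : ℕ) : ℝ :=
  u n t ^ 2 + 2 * lam ^ (2 * n) * ∫ τ in (0 : ℝ)..t, u n τ ^ 2

/-- The `n`-th term on the right of the energy relation at time `t`. -/
def inputTerm (a : ℕ → ℝ) (f u : ℕ → ℝ → ℝ) (t : ℝ) (n : ℕ) : ℝ :=
  a n ^ 2 + 2 * ∫ τ in (0 : ℝ)..t, f n τ * u n τ

/-- Leray–Hopf solutions of the dyadic system on `[0, T]`. -/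
structure IsLerayHopf (lam β T : ℝ) (a : ℕ → ℝ) (f u : ℕ → ℝ → ℝ) : Prop where
  data : AdmissibleData lam T a f
  solves : SolvesDyadic lam β T a f u
  bounded : ∃ C : ℝ, ∀ t ∈ Icc 0 T,
    (Summable fun n : ℕ => u (n + 1) t ^ 2) ∧ ∑' n : ℕ, u (n + 1) t ^ 2 ≤ C
  dissipation :
    Summable fun n : ℕ => lam ^ (2 * (n + 1)) * ∫ t in (0 : ℝ)..T, u (n + 1) t ^ 2
  energy_le : ∀ t ∈ Icc 0 T,
    (Summable fun n : ℕ => energyTerm lam u t (n + 1)) ∧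
    (Summable fun n : ℕ => inputTerm a f u t (n + 1)) ∧
    ∑' n : ℕ, energyTerm lam u t (n + 1) ≤ ∑' n : ℕ, inputTerm a f u t (n + 1)

/-- Equality in the energy relation at every time; both series are required to converge. -/
def EnergyEquality (lam T : ℝ) (a : ℕ → ℝ) (f u : ℕ → ℝ → ℝ) : Prop :=
  ∀ t ∈ Icc 0 T,
    (Summable fun n : ℕ => energyTerm lam u t (n + 1)) ∧
    (Summable fun n : ℕ => inputTerm a f u t (n + 1)) ∧
    ∑' n : ℕ, energyTerm lam u t (n + 1) = ∑' n : ℕ, inputTerm a f u t (n + 1)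

end

/-!
The two solutions are exactly self-similar. Put `μ = lam ^ 2` and `κ = lam ^ (2 - β)`, so `κ < 1`
because `β > 2`. If `U` is a `C¹` function with compact support that vanishes on `(-∞, 1]`, then
`u n t = κ ^ n * U (μ ^ n * t)` solves the system on `[0, 1]` with force
`f n t = (κ * μ) ^ n * F (μ ^ n * t)`, where
`F s = U' s + U s - κ⁻² * U (s / μ) ^ 2 + μ * U s * U (μ * s)`.
Each series in the definition of a Leray–Hopf solution, and the energy flux through the `n`-th
mode, is bounded by a multiple of `κ ^ (2 * n)`. Hence the flux telescopes to zero and the energy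
equality holds (`isLerayHopf_selfSimilar`).

It remains to find two profiles with the same `F`. For `U = A ± B` the two forces agree exactly when
`B' s + B s - 2 κ⁻² A (s / μ) B (s / μ) + μ (A s * B (μ * s) + A (μ * s) * B s) = 0`,
a linear equation for `B` in which `A` is at our disposal. Seen in the modes of the system, `B`
enters from infinitely high frequency at time `0` and moves to lower and lower modes: `A` rotates
the pair (mode `n + 1`, mode `n`) by a right angle, and then amplifies mode `n` alone, before
the next rotation takes place. In terms of an angle `θ` that rises from `0` to `π / 2` on `[1, r]`,
`1 < r < μ`, and an amplitude `exp (-s + e s)`, the choices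
`B s = exp (-s + e s) * sin (θ s) * cos (θ (s / μ))` and
`A s = -θ' s / (μ * √(2 κ⁻²)) - e' (s / μ) / μ`
satisfy the equation, provided that `e` vanishes up to `r` and the amplitude gains exactly the
factor `√(2 κ⁻²)` from `s` to `μ * s` for `s ∈ [1, r]` (`linearized_profile_equation`).
-/

open Filter

/-! ### Self-similar sequences -/

/-- The sequence of functions `t ↦ κ ^ n * U (μ ^ n * t)` with profile `U`. -/
def selfSimilar (κ μ : ℝ) (U : ℝ → ℝ) (n : ℕ) (t : ℝ) : ℝ := κ ^ n * U (μ ^ n * t)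

/-- The profile of the force which makes the self-similar sequence with profile `U` a solution of
the dyadic system; `c` stands for `κ⁻²`. -/
noncomputable def profileForce (μ c : ℝ) (U : ℝ → ℝ) (s : ℝ) : ℝ :=
  deriv U s + U s - c * U (s / μ) ^ 2 + μ * U s * U (μ * s)

theorem continuous_selfSimilar {U : ℝ → ℝ} (hU : Continuous U) (κ μ : ℝ) (n : ℕ) :
    Continuous (selfSimilar κ μ U n) := by
  unfold selfSimilar; fun_prop

theorem hasDerivAt_selfSimilar {U : ℝ → ℝ} (hU : ContDiff ℝ 1 U) (κ μ : ℝ) (n : ℕ) (t : ℝ) :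
    HasDerivAt (selfSimilar κ μ U n) (selfSimilar (κ * μ) μ (deriv U) n t) t := by
  have h1 : HasDerivAt U (deriv U (μ ^ n * t)) (μ ^ n * t) :=
    (hU.differentiable one_ne_zero _).hasDerivAt
  have h2 : HasDerivAt (fun t : ℝ => μ ^ n * t) (μ ^ n) t := by
    simpa using (hasDerivAt_id t).const_mul (μ ^ n)
  have h3 := (h1.comp t h2).const_mul (κ ^ n)
  have h4 : selfSimilar (κ * μ) μ (deriv U) n t = κ ^ n * (deriv U (μ ^ n * t) * μ ^ n) := by
    unfold selfSimilar
    rw [mul_pow]; ring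
  rw [h4]
  exact h3

theorem continuous_profileForce {U : ℝ → ℝ} (hU : ContDiff ℝ 1 U) (μ c : ℝ) :
    Continuous (profileForce μ c U) := by
  have h1 := hU.continuous_deriv le_rfl
  have h2 := hU.continuous
  unfold profileForce
  fun_prop

theorem hasCompactSupport_comp_mul {U : ℝ → ℝ} (hU : HasCompactSupport U) {a : ℝ} (ha : a ≠ 0) :
    HasCompactSupport fun s => U (a * s) := by
  simpa only [smul_eq_mul] using hU.comp_smul ha

theorem hasCompactSupport_profileForce {U : ℝ → ℝ} (hU : HasCompactSupport U) {μ : ℝ}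
    (hμ : μ ≠ 0) (c : ℝ) : HasCompactSupport (profileForce μ c U) := by
  have h1 : HasCompactSupport fun s => U (s / μ) := by
    simpa [div_eq_inv_mul] using hasCompactSupport_comp_mul hU (inv_ne_zero hμ)
  have h2 : HasCompactSupport fun s => c * U (s / μ) ^ 2 := by
    have := (h1.mul_right (f' := fun s => U (s / μ))).mul_left (f := fun _ => c)
    simpa [pow_two, Pi.mul_def] using this
  have h3 : HasCompactSupport fun s => μ * U s * U (μ * s) := by
    have := (hU.mul_left (f := fun _ => μ)).mul_right (f' := fun s => U (μ * s))
    simpa [Pi.mul_def] using this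
  exact ((hU.deriv.add hU).sub h2).add h3

/-- The change of variables `s = a * t` turns integrals of rescaled functions into integrals of the
profile, with a bound that does not depend on the scale. -/
theorem exists_abs_mul_integral_comp_mul_le {G : ℝ → ℝ} (hG : Continuous G)
    (hc : HasCompactSupport G) :
    ∃ C, 0 ≤ C ∧ ∀ a t : ℝ, |a * ∫ τ in (0 : ℝ)..t, G (a * τ)| ≤ C := by
  have hi : Integrable G := hG.integrable_of_hasCompactSupport hc
  refine ⟨∫ x, |G x|, integral_nonneg fun x => abs_nonneg _, fun a t => ?_⟩
  rw [intervalIntegral.mul_integral_comp_mul_left]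
  have h : ‖∫ x in a * 0..a * t, G x‖ ≤ ∫ x in uIoc (a * 0) (a * t), ‖G x‖ :=
    intervalIntegral.norm_integral_le_integral_norm_uIoc
  refine h.trans ?_
  exact setIntegral_le_integral hi.norm (Eventually.of_forall fun x => norm_nonneg _)

theorem summable_of_abs_le_geometric {κ : ℝ} (h0 : 0 < κ) (h1 : κ < 1) {x : ℕ → ℝ} {C : ℝ}
    (h : ∀ n, |x n| ≤ C * (κ ^ 2) ^ n) : Summable x := by
  refine Summable.of_norm_bounded
    ((summable_geometric_of_lt_one (by positivity) ?_).mul_left C) h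
  nlinarith

theorem memLp_two_Ioo {g : ℝ → ℝ} (hg : Continuous g) (T : ℝ) :
    MemLp g 2 (volume.restrict (Ioo 0 T)) := by
  refine MemLp.mono_measure (Measure.restrict_mono Ioo_subset_Icc_self le_rfl) ?_
  obtain ⟨C, hC⟩ := isCompact_Icc.exists_bound_of_continuousOn (hg.continuousOn (s := Icc 0 T))
  exact MemLp.of_bound hg.aestronglyMeasurable C
    ((ae_restrict_mem measurableSet_Icc).mono fun x hx => hC x hx)

theorem hasW12Deriv_of_hasDerivAt {T : ℝ} (hT : 0 ≤ T) {u w : ℝ → ℝ}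
    (hu : ∀ t, HasDerivAt u (w t) t) (hw : Continuous w) : HasW12Deriv T u w := by
  have hcu : Continuous u := continuous_iff_continuousAt.2 fun t => (hu t).continuousAt
  refine ⟨hcu.continuousOn, memLp_two_Ioo hcu T, memLp_two_Ioo hw T, fun φ hφ _ hs => ?_⟩
  have hz : ∀ t, t ∉ Ioo 0 T → φ t = 0 := fun t ht => by
    by_contra h
    exact ht (hs (subset_tsupport _ h))
  have hd : ∀ t, HasDerivAt φ (deriv φ t) t := fun t =>
    (hφ.differentiable (by simp) t).hasDerivAt
  have hcd : Continuous (deriv φ) := hφ.continuous_deriv (by simp)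
  have := intervalIntegral.integral_mul_deriv_eq_deriv_mul (a := 0) (b := T)
    (fun t _ => hu t) (fun t _ => hd t) (hw.intervalIntegrable _ _) (hcd.intervalIntegrable _ _)
  rw [hz 0 (by simp), hz T (by simp), intervalIntegral.integral_of_le hT,
    intervalIntegral.integral_of_le hT, ← integral_Ioc_eq_integral_Ioo,
    ← integral_Ioc_eq_integral_Ioo] at *
  simpa using this

/-! ### Self-similar Leray–Hopf solutions -/

theorem rpow_mul_pow_scaling {lam : ℝ} (hlam : 0 < lam) (β : ℝ) (n : ℕ) :
    lam ^ (β * (n : ℝ)) * (lam ^ (2 - β)) ^ n = (lam ^ 2) ^ n := by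
  rw [← Real.rpow_natCast (lam ^ (2 - β)), ← Real.rpow_mul hlam.le, ← Real.rpow_add hlam,
    ← pow_mul, ← Real.rpow_natCast lam (2 * n)]
  push_cast
  ring_nf

theorem selfSimilar_equation {lam β : ℝ} (hlam : 0 < lam) (U : ℝ → ℝ) (m : ℕ) (t : ℝ) :
    selfSimilar (lam ^ (2 - β) * lam ^ 2) (lam ^ 2) (deriv U) (m + 1) t
        + lam ^ (2 * (m + 1)) * selfSimilar (lam ^ (2 - β)) (lam ^ 2) U (m + 1) t
        - lam ^ (β * ((m + 1 : ℕ) : ℝ)) * selfSimilar (lam ^ (2 - β)) (lam ^ 2) U m t ^ 2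
        + lam ^ (β * (((m + 1 : ℕ) : ℝ) + 1)) * selfSimilar (lam ^ (2 - β)) (lam ^ 2) U (m + 1) t
          * selfSimilar (lam ^ (2 - β)) (lam ^ 2) U (m + 1 + 1) t
      = selfSimilar (lam ^ (2 - β) * lam ^ 2) (lam ^ 2)
          (profileForce (lam ^ 2) ((lam ^ (2 - β)) ^ 2)⁻¹ U) (m + 1) t := by
  have h1 := rpow_mul_pow_scaling hlam β (m + 1)
  have h2 := rpow_mul_pow_scaling hlam β (m + 1 + 1)
  have hκ : lam ^ (2 - β) ≠ 0 := (Real.rpow_pos_of_pos hlam _).ne'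
  rw [show (((m + 1 + 1 : ℕ)) : ℝ) = ((m + 1 : ℕ) : ℝ) + 1 by push_cast; ring] at h2
  unfold selfSimilar profileForce
  generalize lam ^ (β * ((m + 1 : ℕ) : ℝ)) = E at *
  generalize lam ^ (β * (((m + 1 : ℕ) : ℝ) + 1)) = E' at *
  generalize lam ^ (2 - β) = κ at *
  rw [pow_mul]
  have hμ : lam ^ 2 ≠ 0 := (pow_pos hlam 2).ne'
  generalize lam ^ 2 = μ at *
  rw [show μ ^ (m + 1) * t / μ = μ ^ m * t by rw [pow_succ]; field_simp,
    show μ * (μ ^ (m + 1) * t) = μ ^ (m + 1 + 1) * t by ring]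
  have h3 : (κ ^ 2)⁻¹ * κ ^ 2 = 1 := inv_mul_cancel₀ (pow_ne_zero _ hκ)
  have h4 : (κ * μ) ^ (m + 1) * (κ ^ 2)⁻¹ = E * κ ^ (2 * m) := by
    rw [mul_pow, ← h1]
    linear_combination E * κ ^ (2 * m) * h3
  linear_combination (U (μ ^ m * t)) ^ 2 * h4 +
    κ ^ (m + 1) * U (μ ^ (m + 1) * t) * U (μ ^ (m + 1 + 1) * t) * h2

/-- The energy balance of a single mode, with the energy flux `2 λ ^ (β n) ∫ u (n - 1) ^ 2 * u n`
from the mode `n - 1` into the mode `n`. -/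
theorem energyTerm_eq_inputTerm_add_flux {lam β : ℝ} {u f : ℕ → ℝ → ℝ} {w : ℝ → ℝ} {m : ℕ}
    (hu : ∀ n, Continuous (u n)) (hf : Continuous (f (m + 1))) (hw : Continuous w)
    (hd : ∀ t, HasDerivAt (u (m + 1)) (w t) t) (h0 : u (m + 1) 0 = 0)
    (heq : ∀ t, w t + lam ^ (2 * (m + 1)) * u (m + 1) t
        - lam ^ (β * ((m + 1 : ℕ) : ℝ)) * u m t ^ 2
        + lam ^ (β * (((m + 1 : ℕ) : ℝ) + 1)) * u (m + 1) t * u (m + 1 + 1) t = f (m + 1) t)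
    (t : ℝ) :
    energyTerm lam u t (m + 1) = inputTerm (fun _ => 0) f u t (m + 1)
      + 2 * lam ^ (β * ((m + 1 : ℕ) : ℝ)) * (∫ τ in (0 : ℝ)..t, u m τ ^ 2 * u (m + 1) τ)
      - 2 * lam ^ (β * ((m + 1 + 1 : ℕ) : ℝ)) *
        (∫ τ in (0 : ℝ)..t, u (m + 1) τ ^ 2 * u (m + 1 + 1) τ) := by
  rw [show (((m + 1 + 1 : ℕ)) : ℝ) = ((m + 1 : ℕ) : ℝ) + 1 by push_cast; ring]
  generalize lam ^ (β * ((m + 1 : ℕ) : ℝ)) = E at *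
  generalize lam ^ (β * (((m + 1 : ℕ) : ℝ) + 1)) = E' at *
  have hc0 := hu m
  have hc1 := hu (m + 1)
  have hc2 := hu (m + 1 + 1)
  have key : (∫ τ in (0 : ℝ)..t, 2 * u (m + 1) τ * w τ) = u (m + 1) t ^ 2 := by
    rw [intervalIntegral.integral_eq_sub_of_hasDerivAt (f := fun τ => u (m + 1) τ ^ 2)
      (fun τ _ => by simpa [Pi.pow_def] using (hd τ).fun_pow 2)
      (Continuous.intervalIntegrable (by fun_prop) _ _), h0]
    ring
  have hint : (∫ τ in (0 : ℝ)..t, 2 * u (m + 1) τ * w τ) =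
      2 * (∫ τ in (0 : ℝ)..t, f (m + 1) τ * u (m + 1) τ)
      - 2 * lam ^ (2 * (m + 1)) * (∫ τ in (0 : ℝ)..t, u (m + 1) τ ^ 2)
      + 2 * E * (∫ τ in (0 : ℝ)..t, u m τ ^ 2 * u (m + 1) τ)
      - 2 * E' * (∫ τ in (0 : ℝ)..t, u (m + 1) τ ^ 2 * u (m + 1 + 1) τ) := by
    simp_rw [← intervalIntegral.integral_const_mul]
    rw [← intervalIntegral.integral_sub, ← intervalIntegral.integral_add,
      ← intervalIntegral.integral_sub]
    · refine intervalIntegral.integral_congr fun τ _ => ?_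
      linear_combination 2 * u (m + 1) τ * heq τ
    all_goals exact Continuous.intervalIntegrable (by fun_prop) _ _
  unfold energyTerm inputTerm
  linear_combination hint - key

theorem isLerayHopf_selfSimilar {lam β : ℝ} (hlam : 1 < lam) (hβ : 2 < β) {U : ℝ → ℝ}
    (hU : ContDiff ℝ 1 U) (hcs : HasCompactSupport U) (hz : ∀ s ≤ 1, U s = 0) :
    IsLerayHopf lam β 1 (fun _ => 0)
        (selfSimilar (lam ^ (2 - β) * lam ^ 2) (lam ^ 2)
          (profileForce (lam ^ 2) ((lam ^ (2 - β)) ^ 2)⁻¹ U))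
        (selfSimilar (lam ^ (2 - β)) (lam ^ 2) U) ∧
      EnergyEquality lam 1 (fun _ => 0)
        (selfSimilar (lam ^ (2 - β) * lam ^ 2) (lam ^ 2)
          (profileForce (lam ^ 2) ((lam ^ (2 - β)) ^ 2)⁻¹ U))
        (selfSimilar (lam ^ (2 - β)) (lam ^ 2) U) := by
  have hl0 : 0 < lam := by linarith
  have hκ0 : 0 < lam ^ (2 - β) := Real.rpow_pos_of_pos hl0 _
  have hκ1 : lam ^ (2 - β) < 1 := Real.rpow_lt_one_of_one_lt_of_neg hlam (by linarith)
  have hμ0 : 0 < lam ^ 2 := by positivity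
  have hscale := rpow_mul_pow_scaling hl0 β
  have heqn := selfSimilar_equation (β := β) hl0 U
  have hF := continuous_profileForce hU (lam ^ 2) ((lam ^ (2 - β)) ^ 2)⁻¹
  have hFc := hasCompactSupport_profileForce hcs hμ0.ne' ((lam ^ (2 - β)) ^ 2)⁻¹
  have hpow : ∀ n : ℕ, lam ^ (2 * (n + 1)) = (lam ^ 2) ^ (n + 1) := fun n => pow_mul _ _ _
  set κ := lam ^ (2 - β)
  set F := profileForce (lam ^ 2) (κ ^ 2)⁻¹ U
  set u := selfSimilar κ (lam ^ 2) U with hu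
  set f := selfSimilar (κ * lam ^ 2) (lam ^ 2) F with hf
  have hUc := hU.continuous
  have hdUc := hU.continuous_deriv le_rfl
  have huc : ∀ n, Continuous (u n) := fun n => continuous_selfSimilar hUc _ _ _
  have hfc : ∀ n, Continuous (f n) := fun n => continuous_selfSimilar hF _ _ _
  have hu0 : ∀ t ≤ 1, u 0 t = 0 := fun t ht => by simp [hu, selfSimilar, hz t ht]
  have hinit : ∀ n, u n 0 = 0 := fun n => by simp [hu, selfSimilar, hz 0 zero_le_one]
  -- `M` bounds `U ^ 2`; `CU`, `CF`, `CG` bound the scaled integrals of `U ^ 2`, of `F ^ 2` and of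
  -- the flux density `U s ^ 2 * U (μ s)`.
  obtain ⟨M₀, hM₀⟩ := hUc.bounded_above_of_compact_support hcs
  have hM : ∀ s, U s ^ 2 ≤ M₀ ^ 2 := fun s => by
    rw [← sq_abs]
    exact pow_le_pow_left₀ (abs_nonneg _) (hM₀ s) 2
  have hsq : ∀ {G : ℝ → ℝ}, HasCompactSupport G → HasCompactSupport fun s => G s ^ 2 :=
    fun {G} h => by simpa [pow_two, Pi.mul_def] using h.mul_right (f' := G)
  obtain ⟨CU, hCU0, hCU⟩ := exists_abs_mul_integral_comp_mul_le (G := fun s => U s ^ 2)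
    (by fun_prop) (hsq hcs)
  obtain ⟨CF, hCF0, hCF⟩ := exists_abs_mul_integral_comp_mul_le (G := fun s => F s ^ 2)
    (by fun_prop) (hsq hFc)
  obtain ⟨CG, hCG0, hCG⟩ := exists_abs_mul_integral_comp_mul_le
    (G := fun s => U s ^ 2 * U (lam ^ 2 * s)) (by fun_prop)
    (by simpa [Pi.mul_def] using (hsq hcs).mul_right (f' := fun s => U (lam ^ 2 * s)))
  have hle : ∀ {C : ℝ}, 0 ≤ C → ∀ n : ℕ, C * (κ ^ 2) ^ (n + 1) ≤ C * (κ ^ 2) ^ n :=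
    fun hC n => mul_le_mul_of_nonneg_left
      (pow_le_pow_of_le_one (by positivity) (by nlinarith) (Nat.le_succ n)) hC
  have hdiss : ∀ (t : ℝ) (n : ℕ),
      |lam ^ (2 * (n + 1)) * ∫ τ in (0 : ℝ)..t, u (n + 1) τ ^ 2| ≤ CU * (κ ^ 2) ^ n := by
    intro t n
    refine le_trans ?_ (hle hCU0 n)
    have : lam ^ (2 * (n + 1)) * ∫ τ in (0 : ℝ)..t, u (n + 1) τ ^ 2 =
        ((lam ^ 2) ^ (n + 1) * ∫ τ in (0 : ℝ)..t, U ((lam ^ 2) ^ (n + 1) * τ) ^ 2)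
          * (κ ^ 2) ^ (n + 1) := by
      simp only [hu, selfSimilar, mul_pow, intervalIntegral.integral_const_mul, hpow]
      ring
    rw [this, abs_mul, abs_of_pos (by positivity : 0 < (κ ^ 2) ^ (n + 1))]
    gcongr
    exact hCU _ _
  have hforce : ∀ n : ℕ,
      |(lam ^ (2 * (n + 1)))⁻¹ * ∫ t in (0 : ℝ)..1, f (n + 1) t ^ 2| ≤ CF * (κ ^ 2) ^ n := by
    intro n
    refine le_trans ?_ (hle hCF0 n)
    have : (lam ^ (2 * (n + 1)))⁻¹ * ∫ t in (0 : ℝ)..1, f (n + 1) t ^ 2 =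
        ((lam ^ 2) ^ (n + 1) * ∫ τ in (0 : ℝ)..1, F ((lam ^ 2) ^ (n + 1) * τ) ^ 2)
          * (κ ^ 2) ^ (n + 1) := by
      simp only [hf, selfSimilar, mul_pow, intervalIntegral.integral_const_mul, hpow]
      field_simp
      ring
    rw [this, abs_mul, abs_of_pos (by positivity : 0 < (κ ^ 2) ^ (n + 1))]
    gcongr
    exact hCF _ _
  have husq : ∀ (t : ℝ) (n : ℕ), u (n + 1) t ^ 2 ≤ M₀ ^ 2 * (κ ^ 2) ^ n := by
    intro t n
    refine le_trans ?_ (hle (sq_nonneg M₀) n)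
    have : u (n + 1) t ^ 2 = U ((lam ^ 2) ^ (n + 1) * t) ^ 2 * (κ ^ 2) ^ (n + 1) := by
      simp only [hu, selfSimilar]; ring
    rw [this]
    exact mul_le_mul_of_nonneg_right (hM _) (by positivity)
  set Φ : ℝ → ℕ → ℝ := fun t m =>
    2 * lam ^ (β * ((m + 1 : ℕ) : ℝ)) * ∫ τ in (0 : ℝ)..t, u m τ ^ 2 * u (m + 1) τ with hΦ
  have hΦle : ∀ t m, |Φ t m| ≤ 2 * lam ^ 2 * CG * (κ ^ 2) ^ m := by
    intro t m
    have : Φ t m = 2 * lam ^ 2 * ((lam ^ 2) ^ m *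
        ∫ τ in (0 : ℝ)..t, U ((lam ^ 2) ^ m * τ) ^ 2 * U (lam ^ 2 * ((lam ^ 2) ^ m * τ)))
          * (κ ^ 2) ^ m := by
      have h1 : ∀ τ, u m τ ^ 2 * u (m + 1) τ = (κ ^ 2) ^ m * κ ^ (m + 1) *
          (U ((lam ^ 2) ^ m * τ) ^ 2 * U (lam ^ 2 * ((lam ^ 2) ^ m * τ))) := fun τ => by
        simp only [hu, selfSimilar]
        rw [show (lam ^ 2) ^ (m + 1) * τ = lam ^ 2 * ((lam ^ 2) ^ m * τ) by ring]
        ring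
      simp only [hΦ, h1, intervalIntegral.integral_const_mul]
      have h2 := hscale (m + 1)
      generalize (∫ τ in (0 : ℝ)..t, U ((lam ^ 2) ^ m * τ) ^ 2 *
        U (lam ^ 2 * ((lam ^ 2) ^ m * τ))) = I
      linear_combination 2 * (κ ^ 2) ^ m * I * h2
    rw [this, abs_mul, abs_mul, abs_of_pos (by positivity : 0 < (κ ^ 2) ^ m),
      abs_of_pos (by positivity : 0 < 2 * lam ^ 2)]
    gcongr
    exact hCG _ _
  have hΦ0 : ∀ t ∈ Icc (0 : ℝ) 1, Φ t 0 = 0 := by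
    intro t ht
    have : (∫ τ in (0 : ℝ)..t, u 0 τ ^ 2 * u (0 + 1) τ) = 0 := by
      rw [intervalIntegral.integral_congr (g := fun _ => (0 : ℝ))]
      · simp
      · intro τ hτ
        rw [uIcc_of_le ht.1] at hτ
        simp [hu0 τ (hτ.2.trans ht.2)]
    simp only [hΦ, this, mul_zero]
  have hdata : AdmissibleData lam 1 (fun _ => 0) f := by
    exact ⟨by simp [summable_zero], fun n _ => memLp_two_Ioo (hfc n) 1,
      summable_of_abs_le_geometric hκ0 hκ1 hforce⟩
  have hsolves : SolvesDyadic lam β 1 (fun _ => 0) f u := by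
    refine ⟨fun t ht => hu0 t ht.2, fun n _ => hinit n, fun n hn => ?_⟩
    obtain ⟨m, rfl⟩ : ∃ m, n = m + 1 := ⟨n - 1, by omega⟩
    refine ⟨selfSimilar (κ * lam ^ 2) (lam ^ 2) (deriv U) (m + 1),
      hasW12Deriv_of_hasDerivAt zero_le_one (hasDerivAt_selfSimilar hU _ _ _)
        (continuous_selfSimilar hdUc _ _ _), Eventually.of_forall fun t => ?_⟩
    exact heqn m t
  have henergy : EnergyEquality lam 1 (fun _ => 0) f u := by
    intro t ht
    have hbal : ∀ m, inputTerm (fun _ => 0) f u t (m + 1) =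
        energyTerm lam u t (m + 1) - (Φ t m - Φ t (m + 1)) := fun m => by
      have := energyTerm_eq_inputTerm_add_flux (β := β) huc (hfc (m + 1))
        (continuous_selfSimilar hdUc _ _ _) (hasDerivAt_selfSimilar hU κ (lam ^ 2) (m + 1))
        (hinit _) (heqn m) t
      simp only [hΦ]
      linarith
    have hE : Summable fun n : ℕ => energyTerm lam u t (n + 1) := by
      refine (summable_of_abs_le_geometric hκ0 hκ1 (C := M₀ ^ 2) (x := fun n => u (n + 1) t ^ 2)
        fun n => ?_).add ((summable_of_abs_le_geometric hκ0 hκ1 (hdiss t)).mul_left 2) |>.congr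
        fun n => ?_
      · rw [abs_of_nonneg (sq_nonneg _)]
        exact husq t n
      · unfold energyTerm; ring
    have hΦs : Summable (Φ t) := summable_of_abs_le_geometric hκ0 hκ1 (hΦle t)
    have hΦs' : Summable fun m => Φ t (m + 1) := (summable_nat_add_iff 1).2 hΦs
    have htel : ∑' m, (Φ t m - Φ t (m + 1)) = 0 := by
      rw [hΦs.tsum_sub hΦs', hΦs.tsum_eq_zero_add, hΦ0 t ht]
      ring
    refine ⟨hE, ?_, ?_⟩
    · simp_rw [hbal]
      exact hE.sub (hΦs.sub hΦs')
    · simp_rw [hbal]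
      rw [hE.tsum_sub (hΦs.sub hΦs'), htel, sub_zero]
  refine ⟨⟨hdata, hsolves, ⟨∑' n, M₀ ^ 2 * (κ ^ 2) ^ n, fun t _ => ?_⟩,
    summable_of_abs_le_geometric hκ0 hκ1 (hdiss 1),
    fun t ht => ⟨(henergy t ht).1, (henergy t ht).2.1, (henergy t ht).2.2.le⟩⟩, henergy⟩
  have hg : Summable fun n : ℕ => M₀ ^ 2 * (κ ^ 2) ^ n :=
    (summable_geometric_of_lt_one (by positivity) (by nlinarith)).mul_left _
  have hs : Summable fun n : ℕ => u (n + 1) t ^ 2 :=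
    Summable.of_nonneg_of_le (fun n => sq_nonneg _) (husq t) hg
  exact ⟨hs, hs.tsum_le_tsum (husq t) hg⟩

/-! ### Two profiles with the same force -/

/-- The linear equation for half the difference `B` of two profiles `A ± B` with the same force. -/
theorem profileForce_add_eq_sub {μ c : ℝ} {A B : ℝ → ℝ} (hA : Differentiable ℝ A)
    (hB : Differentiable ℝ B)
    (h : ∀ s, deriv B s + B s - 2 * c * (A (s / μ) * B (s / μ))
      + μ * (A s * B (μ * s) + A (μ * s) * B s) = 0) :
    profileForce μ c (A + B) = profileForce μ c (A - B) := by
  funext s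
  unfold profileForce
  rw [deriv_add (hA s) (hB s), deriv_sub (hA s) (hB s)]
  simp only [Pi.add_apply, Pi.sub_apply]
  linear_combination 2 * h s

/-- The derivative also vanishes at boundary points of `S`, such as the end of a half-line. -/
theorem deriv_eq_zero_of_eqOn_const {f : ℝ → ℝ} {S : Set ℝ} (hS : UniqueDiffOn ℝ S)
    (hf : Differentiable ℝ f) {a : ℝ} (h : ∀ s ∈ S, f s = a) {s : ℝ} (hs : s ∈ S) :
    deriv f s = 0 := by
  rw [← (hf s).derivWithin (hS s hs), derivWithin_congr h (h s hs)]
  simp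

theorem exists_smooth_angle {r : ℝ} (hr : 1 < r) : ∃ θ : ℝ → ℝ, ContDiff ℝ ∞ θ ∧
    (∀ s ≤ 1, θ s = 0) ∧ ∀ s, r ≤ s → θ s = Real.pi / 2 := by
  have h : 0 < r - 1 := by linarith
  refine ⟨fun s => Real.pi / 2 * Real.smoothTransition ((s - 1) / (r - 1)), ?_, ?_, ?_⟩
  · exact contDiff_const.mul (Real.smoothTransition.contDiff.comp (by fun_prop))
  · intro s hs
    beta_reduce
    rw [Real.smoothTransition.zero_of_nonpos
      (div_nonpos_of_nonpos_of_nonneg (by linarith) h.le), mul_zero]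
  · intro s hs
    beta_reduce
    rw [Real.smoothTransition.one_of_one_le ((one_le_div h).2 (by linarith)), mul_one]

/-- A correction `e` of the exponent which makes `exp (-s + e s)` decay like `exp (-s / μ)` on
`[μ, μ r]`, with an arbitrary gain `exp K` between `s` and `μ * s` for `s ∈ [1, r]`. -/
theorem exists_smooth_exponent {μ r : ℝ} (hrμ : r < μ) (K : ℝ) :
    ∃ e : ℝ → ℝ, ContDiff ℝ ∞ e ∧ HasCompactSupport e ∧ (∀ s ≤ r, e s = 0) ∧
      ∀ s, μ ≤ s → s ≤ μ * r → e s = (1 - 1 / μ) * s + K := by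
  have h : 0 < μ - r := by linarith
  have hz1 : ∀ s ≤ r, Real.smoothTransition ((s - r) / (μ - r)) = 0 := fun s hs =>
    Real.smoothTransition.zero_of_nonpos (div_nonpos_of_nonpos_of_nonneg (by linarith) h.le)
  refine ⟨fun s => ((1 - 1 / μ) * s + K) * (Real.smoothTransition ((s - r) / (μ - r)) *
    Real.smoothTransition (μ * r + 1 - s)), ?_, ?_, ?_, ?_⟩
  · exact (by fun_prop : ContDiff ℝ ∞ fun s : ℝ => (1 - 1 / μ) * s + K).mul
      ((Real.smoothTransition.contDiff.comp (by fun_prop)).mul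
        (Real.smoothTransition.contDiff.comp (by fun_prop)))
  · refine HasCompactSupport.intro (isCompact_Icc (a := r) (b := μ * r + 1)) fun s hs => ?_
    rcases le_or_gt s r with h1 | h1
    · simp [hz1 s h1]
    · have : μ * r + 1 - s ≤ 0 := by
        by_contra h2
        exact hs ⟨h1.le, by linarith⟩
      simp [Real.smoothTransition.zero_of_nonpos this]
  · intro s hs
    simp [hz1 s hs]
  · intro s h1 h2
    simp only
    rw [Real.smoothTransition.one_of_one_le ((one_le_div h).2 (by linarith)),
      Real.smoothTransition.one_of_one_le (by linarith)]
    ring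

/-- The profile `B` of the difference: the factor `sin (θ s)` describes the entry into a mode, the
factor `cos (θ (s / μ))` the exit from it. -/
noncomputable def diffProfile (μ : ℝ) (θ e : ℝ → ℝ) (s : ℝ) : ℝ :=
  Real.exp (-s + e s) * (Real.sin (θ s) * Real.cos (θ (s / μ)))

/-- The mean profile `A`: its first part rotates two neighbouring modes of the difference into each
other, its second part amplifies a mode. The number `k` stands for `√(2c)`. -/
noncomputable def meanProfile (μ k : ℝ) (θ e : ℝ → ℝ) (s : ℝ) : ℝ :=
  -(deriv θ s / (μ * k)) - deriv e (s / μ) / μ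

/-- The equation of `profileForce_add_eq_sub` for `meanProfile` and `diffProfile`, with
`2 * c = k ^ 2`: the terms in `θ'` are the rotation of neighbouring modes and cancel those in `B'`,
and the term in `e'` balances the growth of the amplitude. All other products vanish because the
supports of their factors are disjoint. -/
theorem linearized_profile_equation {μ r k : ℝ} (hr : 1 < r) (hrμ : r < μ) (hk : 0 < k)
    {θ e : ℝ → ℝ} (hθ : Differentiable ℝ θ) (he : Differentiable ℝ e)
    (hθ0 : ∀ s ≤ 1, θ s = 0) (hθ1 : ∀ s, r ≤ s → θ s = Real.pi / 2) (he0 : ∀ s ≤ r, e s = 0)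
    (he1 : ∀ s, μ ≤ s → s ≤ μ * r → e s = (1 - 1 / μ) * s + Real.log k) (s : ℝ) :
    deriv (diffProfile μ θ e) s + diffProfile μ θ e s
      - k ^ 2 * (meanProfile μ k θ e (s / μ) * diffProfile μ θ e (s / μ))
      + μ * (meanProfile μ k θ e s * diffProfile μ θ e (μ * s)
        + meanProfile μ k θ e (μ * s) * diffProfile μ θ e s) = 0 := by
  have hμ : 0 < μ := by linarith
  have hθd0 : ∀ s ≤ 1, deriv θ s = 0 := fun s hs =>
    deriv_eq_zero_of_eqOn_const (uniqueDiffOn_Iic 1) hθ hθ0 hs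
  have hθd1 : ∀ s, r ≤ s → deriv θ s = 0 := fun s hs =>
    deriv_eq_zero_of_eqOn_const (uniqueDiffOn_Ici r) hθ hθ1 hs
  have hed0 : ∀ s ≤ r, deriv e s = 0 := fun s hs =>
    deriv_eq_zero_of_eqOn_const (uniqueDiffOn_Iic r) he he0 hs
  have hB0 : ∀ s ≤ 1, diffProfile μ θ e s = 0 := fun s hs => by simp [diffProfile, hθ0 s hs]
  have hB1 : ∀ s, μ * r ≤ s → diffProfile μ θ e s = 0 := fun s hs => by
    have : r ≤ s / μ := by rw [le_div_iff₀ hμ]; linarith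
    simp [diffProfile, hθ1 _ this]
  -- The gain of the amplitude between neighbouring modes.
  have hgain : ∀ σ, 1 ≤ σ → σ ≤ r →
      Real.exp (-(μ * σ) + e (μ * σ)) = k * Real.exp (-σ + e σ) := fun σ h1 h2 => by
    rw [he0 σ h2, he1 _ (le_mul_of_one_le_right hμ.le h1) (mul_le_mul_of_nonneg_left h2 hμ.le),
      show -(μ * σ) + ((1 - 1 / μ) * (μ * σ) + Real.log k) = Real.log k + (-σ + 0) by
        field_simp; ring, Real.exp_add, Real.exp_log hk]
  -- One factor of `B` is constant wherever the angle in the other one moves.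
  have hcos : deriv θ s * Real.cos (θ (s / μ)) = deriv θ s := by
    rcases le_or_gt r s with h | h
    · simp [hθd1 s h]
    · simp [hθ0 (s / μ) (by rw [div_le_one hμ]; linarith)]
  have hsin : Real.sin (θ s) * deriv θ (s / μ) = deriv θ (s / μ) := by
    rcases le_or_gt s r with h | h
    · rw [hθd0 (s / μ) (by rw [div_le_one hμ]; linarith), mul_zero]
    · simp [hθ1 s h.le]
  have hD : HasDerivAt (diffProfile μ θ e)
      (Real.exp (-s + e s) * (-1 + deriv e s) * (Real.sin (θ s) * Real.cos (θ (s / μ)))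
        + Real.exp (-s + e s) * (Real.cos (θ s) * deriv θ s * Real.cos (θ (s / μ))
          + Real.sin (θ s) * (-Real.sin (θ (s / μ)) * (deriv θ (s / μ) * (1 / μ))))) s := by
    have h1 : HasDerivAt (fun s => -s + e s) (-1 + deriv e s) s :=
      (hasDerivAt_neg s).add (he s).hasDerivAt
    have h2 : HasDerivAt (fun s => θ (s / μ)) (deriv θ (s / μ) * (1 / μ)) s :=
      (hθ (s / μ)).hasDerivAt.comp s ((hasDerivAt_id s).div_const μ)
    exact h1.exp.mul ((hθ s).hasDerivAt.sin.mul h2.cos)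
  have hAB1 : meanProfile μ k θ e (μ * s) * diffProfile μ θ e s =
      -(deriv e s / μ) * diffProfile μ θ e s := by
    unfold meanProfile
    rw [mul_div_cancel_left₀ _ hμ.ne']
    rcases le_or_gt s 1 with h | h
    · simp [hB0 s h]
    · rw [hθd1 (μ * s) (by nlinarith)]; ring
  have hAB2 : μ * (meanProfile μ k θ e s * diffProfile μ θ e (μ * s)) =
      -(deriv θ s * (Real.exp (-s + e s) * Real.cos (θ s))) := by
    rcases le_or_gt r s with h | h
    · rw [hB1 (μ * s) (mul_le_mul_of_nonneg_left h hμ.le), hθd1 s h]; ring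
    · have h3 : deriv e (s / μ) = 0 := hed0 _ (by rw [div_le_iff₀ hμ]; nlinarith)
      rcases le_or_gt s 1 with h1 | h1
      · simp [meanProfile, h3, hθd0 s h1]
      · unfold meanProfile diffProfile
        rw [h3, hgain s h1.le h.le, mul_div_cancel_left₀ _ hμ.ne',
          hθ1 (μ * s) (by nlinarith), Real.sin_pi_div_two]
        field_simp
        ring
  have hAB3 : k ^ 2 * (meanProfile μ k θ e (s / μ) * diffProfile μ θ e (s / μ)) =
      -(deriv θ (s / μ) * (1 / μ) * (Real.exp (-s + e s) * Real.sin (θ (s / μ)))) := by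
    have hs : s = μ * (s / μ) := by field_simp
    set σ := s / μ
    rcases le_or_gt σ 1 with h | h
    · rw [hB0 σ h, hθd0 σ h]; ring
    rcases le_or_gt r σ with h1 | h1
    · rw [hθd1 σ h1]
      rcases le_or_gt (μ * r) σ with h2 | h2
      · rw [hB1 σ h2]; ring
      · have : deriv e (σ / μ) = 0 := hed0 _ (by rw [div_le_iff₀ hμ]; linarith)
        simp [meanProfile, this, hθd1 σ h1]
    · have h3 : deriv e (σ / μ) = 0 := hed0 _ (by rw [div_le_iff₀ hμ]; nlinarith)
      unfold meanProfile diffProfile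
      rw [h3, hs, hgain σ h.le h1.le,
        hθ0 (σ / μ) (by rw [div_le_one hμ]; linarith), Real.cos_zero]
      field_simp
      ring
  rw [hD.deriv, hAB3, mul_add μ, hAB2, hAB1]
  unfold diffProfile
  field_simp
  linear_combination Real.exp (-s + e s) *
    (μ * Real.cos (θ s) * hcos - Real.sin (θ (s / μ)) * hsin)

theorem exists_profiles {μ c : ℝ} (hμ : 1 < μ) (hc : 0 < c) :
    ∃ A B : ℝ → ℝ, ContDiff ℝ 1 A ∧ ContDiff ℝ 1 B ∧ HasCompactSupport A ∧ HasCompactSupport B ∧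
      (∀ s ≤ 1, A s = 0) ∧ (∀ s ≤ 1, B s = 0) ∧ B μ ≠ 0 ∧
      profileForce μ c (A + B) = profileForce μ c (A - B) := by
  obtain ⟨r, hr, hrμ⟩ := exists_between hμ
  have hμ0 : 0 < μ := by linarith
  have hk : 0 < √(2 * c) := Real.sqrt_pos.2 (by linarith)
  obtain ⟨θ, hθ, hθ0, hθ1⟩ := exists_smooth_angle hr
  obtain ⟨e, he, hec, he0, he1⟩ := exists_smooth_exponent hrμ (Real.log √(2 * c))
  have hθD : Differentiable ℝ θ := hθ.differentiable (by simp)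
  have heD : Differentiable ℝ e := he.differentiable (by simp)
  have hθ' : ContDiff ℝ 1 (deriv θ) := (contDiff_infty_iff_deriv.1 hθ).2.of_le (by norm_cast)
  have he' : ContDiff ℝ 1 (deriv e) := (contDiff_infty_iff_deriv.1 he).2.of_le (by norm_cast)
  have hA : ContDiff ℝ 1 (meanProfile μ √(2 * c) θ e) := by
    unfold meanProfile
    have : ContDiff ℝ 1 fun s => deriv e (s / μ) := he'.comp (by fun_prop)
    fun_prop
  have hB : ContDiff ℝ 1 (diffProfile μ θ e) := by
    have h1 : ContDiff ℝ 1 θ := hθ.of_le (by norm_cast)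
    have h2 : ContDiff ℝ 1 e := he.of_le (by norm_cast)
    have h3 : ContDiff ℝ 1 fun s => θ (s / μ) := h1.comp (by fun_prop)
    unfold diffProfile
    fun_prop
  have hθd0 : ∀ s ≤ 1, deriv θ s = 0 := fun s hs =>
    deriv_eq_zero_of_eqOn_const (uniqueDiffOn_Iic 1) hθD hθ0 hs
  have hθd1 : ∀ s, r ≤ s → deriv θ s = 0 := fun s hs =>
    deriv_eq_zero_of_eqOn_const (uniqueDiffOn_Ici r) hθD hθ1 hs
  have hed0 : ∀ s ≤ r, deriv e s = 0 := fun s hs =>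
    deriv_eq_zero_of_eqOn_const (uniqueDiffOn_Iic r) heD he0 hs
  have hB0 : ∀ s ≤ 1, diffProfile μ θ e s = 0 := fun s hs => by simp [diffProfile, hθ0 s hs]
  refine ⟨meanProfile μ √(2 * c) θ e, diffProfile μ θ e, hA, hB, ?_, ?_, ?_, hB0, ?_,
    profileForce_add_eq_sub (hA.differentiable one_ne_zero) (hB.differentiable one_ne_zero)
      fun s => ?_⟩
  · have h1 : HasCompactSupport (deriv θ) :=
      HasCompactSupport.intro (isCompact_Icc (a := 1) (b := r)) fun s hs => by
        rcases le_or_gt s 1 with h | h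
        · exact hθd0 s h
        · exact hθd1 s (not_lt.1 fun h' => hs ⟨h.le, h'.le⟩)
    have h2 : HasCompactSupport fun s => deriv e (s / μ) := by
      simpa [div_eq_inv_mul] using hasCompactSupport_comp_mul hec.deriv (inv_ne_zero hμ0.ne')
    have h3 := (h1.mul_right (f' := fun _ => -(μ * √(2 * c))⁻¹)).sub
      (h2.mul_right (f' := fun _ => μ⁻¹))
    have h4 : meanProfile μ √(2 * c) θ e = deriv θ * (fun _ => -(μ * √(2 * c))⁻¹) -
        (fun s => deriv e (s / μ)) * fun _ => μ⁻¹ := by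
      funext s
      simp only [meanProfile, Pi.sub_apply, Pi.mul_apply]
      ring
    rw [h4]
    exact h3
  · refine HasCompactSupport.intro (isCompact_Icc (a := 1) (b := μ * r)) fun s hs => ?_
    rcases le_or_gt s 1 with h | h
    · exact hB0 s h
    · have : μ * r ≤ s := not_lt.1 fun h' => hs ⟨h.le, h'.le⟩
      have : r ≤ s / μ := by rw [le_div_iff₀ hμ0]; linarith
      simp [diffProfile, hθ1 _ this]
  · intro s hs
    have : s / μ ≤ r := by rw [div_le_iff₀ hμ0]; nlinarith
    simp [meanProfile, hθd0 s hs, hed0 _ this]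
  · simp [diffProfile, hθ1 μ hrμ.le, hθ0, div_self hμ0.ne']
  · have := linearized_profile_equation hr hrμ hk hθD heD hθ0 hθ1 he0 he1 s
    rwa [Real.sq_sqrt (by linarith)] at this

theorem theorem4 (lam β : ℝ) (hlam : 1 < lam) (hβ : 2 < β) :
    ∃ T : ℝ, 0 < T ∧ ∃ f : ℕ → ℝ → ℝ,
      AdmissibleData lam T (fun _ => 0) f ∧
      ∃ uPlus uMinus : ℕ → ℝ → ℝ,
        IsLerayHopf lam β T (fun _ => 0) f uPlus ∧
        IsLerayHopf lam β T (fun _ => 0) f uMinus ∧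
        EnergyEquality lam T (fun _ => 0) f uPlus ∧
        EnergyEquality lam T (fun _ => 0) f uMinus ∧
        ∃ n : ℕ, 1 ≤ n ∧ ∃ t ∈ Set.Icc 0 T, uPlus n t ≠ uMinus n t := by
  have hκ : 0 < lam ^ (2 - β) := Real.rpow_pos_of_pos (by linarith) _
  obtain ⟨A, B, hA, hB, hAc, hBc, hA0, hB0, hne, hF⟩ :=
    exists_profiles (μ := lam ^ 2) (c := ((lam ^ (2 - β)) ^ 2)⁻¹) (by nlinarith) (by positivity)
  obtain ⟨h1, h2⟩ := isLerayHopf_selfSimilar hlam hβ (U := A + B) (hA.add hB) (hAc.add hBc)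
    fun s hs => by simp [hA0 s hs, hB0 s hs]
  obtain ⟨h3, h4⟩ := isLerayHopf_selfSimilar hlam hβ (U := A - B) (hA.sub hB) (hAc.sub hBc)
    fun s hs => by simp [hA0 s hs, hB0 s hs]
  rw [← hF] at h3 h4
  -- The solutions differ in the mode `1` at time `1`, where their difference is `2 κ B μ`.
  refine ⟨1, one_pos, _, h1.data, _, _, h1, h3, h2, h4, 1, le_rfl, 1, by simp, fun h => hne ?_⟩
  simp only [selfSimilar, pow_one, mul_one, Pi.add_apply, Pi.sub_apply] at h
  have := mul_left_cancel₀ hκ.ne' h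
  linarith
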